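/- Let $H$ be a (real or complex) Hilbert space and let $A$ be a self-adjoint, densely defined, generally unbounded operator in $H$ that is positive definite, $(Au,u)\ge\alpha\|u\|^2$ for $u\in D(A)$, $\alpha>0$. Let $A=\sum_{j=1}^m A_j$ (so $D(A)=\bigcap_j D(A_j)$), where every $A_j$ is self-adjoint and $(A_ju,u)\ge\alpha_j\|u\|^2$ for $u\in D(A_j)$, $\alpha_j>0$. Let $M:H\to H$ be Lipschitz continuous, $T>0$, $f:[0,T]\to H$ continuous and $\varphi_0,\varphi_1\in H$. Suppose that the Cauchy problem $$u''(t)+Au(t)+M(u(t))=f(t),\quad t\in[0,T],\qquad u(0)=\varphi_0,\quad u'(0)=\varphi_1,$$ has a solution $u$; that is, $u:[0,T]\to H$ is twice continuously differentiable, $u(t)\in D(A)$ for all $t\in[0,T]$, the functions $t\mapsto Au(t)$ and $t\mapsto M(u(t))$ are continuous, and the equation and the initial conditions hold. Let $\eta_1,\dots,\eta_m\in(0,1)$ with $\sum_{j=1}^m\eta_j=1$. For an integer $n>1$ put $\tau=T/n$, $t_k=k\tau$, and define $v_0,\dots,v_n$ by $v_0=\varphi_0$, $v_1=\varphi_0+\tau\varphi_1$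 and, for $k=1,\dots,n-1$, $v_{k+1}=\sum_{j=1}^m\eta_j y_{j,k+1}$, where $y_{j,k+1}\in D(A_j)$ solves $$\eta_j\,\frac{y_{j,k+1}-2v_k+v_{k-1}}{\tau^2}+A_jy_{j,k+1}=\delta_{1,j}\,\bigl[f(t_k)-M(v_k)\bigr],\qquad j=1,\dots,m,$$ with $\delta_{1,j}$ the Kronecker symbol. If $f$ and $u''$ satisfy on $[0,T]$ the Hölder condition with exponent $\lambda\in(0,1]$, then there is a constant $c>0$, independent of $n$ and $k$, such that for all integers $n>1$ and all $k=0,\dots,n-1$ $$\left\|u'(t_k)-\frac{v_{k+1}-v_k}{\tau}\right\|\le c\,\tau^{\lambda}.$$ -/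

import Mathlib

open Set

/-- `A` is a densely defined self-adjoint operator in `H` that is positive definite with
constant `α > 0`: `(A u, u) ≥ α ‖u‖²` for all `u ∈ D(A)`. -/
structure IsSelfAdjointPosDef {𝕜 H : Type*} [RCLike 𝕜] [NormedAddCommGroup H]
    [InnerProductSpace 𝕜 H] [CompleteSpace H] (A : H →ₗ.[𝕜] H) (α : ℝ) : Prop where
  dense : Dense (A.domain : Set H)
  selfAdjoint : IsSelfAdjoint A
  pos : 0 < α
  le_inner : ∀ u : A.domain, α * ‖(u : H)‖ ^ 2 ≤ RCLike.re (inner 𝕜 (A u) (u : H))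

/-- `u` is a (classical) solution on `[0, T]` of the Cauchy problem
`u'' + A u + M(u) = f`, `u(0) = φ₀`, `u'(0) = φ₁`. Derivatives at the endpoints of `[0, T]` are
one-sided. -/
structure IsCauchySolution {𝕜 H : Type*} [RCLike 𝕜] [NormedAddCommGroup H]
    [InnerProductSpace 𝕜 H] [NormedSpace ℝ H] (A : H →ₗ.[𝕜] H) (M : H → H) (f : ℝ → H)
    (φ₀ φ₁ : H) (T : ℝ) (u : ℝ → H) : Prop where
  contDiffOn : ContDiffOn ℝ 2 u (Icc 0 T)
  mem_domain : ∀ t ∈ Icc (0 : ℝ) T, u t ∈ A.domain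
  continuous_op : Continuous fun t : Icc (0 : ℝ) T => A ⟨u t, mem_domain t t.2⟩
  continuousOn_nonlinear : ContinuousOn (fun t => M (u t)) (Icc 0 T)
  equation : ∀ (t : ℝ) (ht : t ∈ Icc (0 : ℝ) T),
    iteratedDerivWithin 2 u (Icc 0 T) t + A ⟨u t, mem_domain t ht⟩ + M (u t) = f t
  initial_value : u 0 = φ₀
  initial_deriv : derivWithin u (Icc 0 T) 0 = φ₁

/-- `v 0, …, v n` is the approximate solution given by the parallel decomposition scheme with
operators `A₁, …, A_m`, weights `η₁, …, η_m` and step `τ`, the nodes being `t_k = k τ`: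
`v 0 = φ₀`, `v 1 = φ₀ + τ φ₁`, and for `1 ≤ k ≤ n - 1` one has `v (k+1) = ∑ j, η_j y_{j,k+1}`,
where `y_{j,k+1} ∈ D(A_j)` solves
`η_j (y_{j,k+1} - 2 v k + v (k-1)) / τ² + A_j y_{j,k+1} = δ_{1,j} (f(t_k) - M(v k))`.
The operators are indexed by `Fin m`, so the index `j = 1` is the element of value `0`. -/
structure IsDecompositionScheme {𝕜 H : Type*} [RCLike 𝕜] [NormedAddCommGroup H]
    [InnerProductSpace 𝕜 H] [NormedSpace ℝ H] {m : ℕ} (Aj : Fin m → (H →ₗ.[𝕜] H))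
    (η : Fin m → ℝ) (M : H → H) (f : ℝ → H) (φ₀ φ₁ : H) (τ : ℝ) (n : ℕ) (v : ℕ → H) : Prop where
  zero : v 0 = φ₀
  one : v 1 = φ₀ + τ • φ₁
  step : ∀ k : ℕ, 1 ≤ k → k ≤ n - 1 → ∃ y : (j : Fin m) → (Aj j).domain,
    (∀ j : Fin m,
      η j • ((τ ^ 2)⁻¹ • ((y j : H) - (2 : ℝ) • v k + v (k - 1))) + Aj j (y j) =
        if (j : ℕ) = 0 then f (k * τ) - M (v k) else 0) ∧
    v (k + 1) = ∑ j : Fin m, η j • (y j : H)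

/-! Put `P_j = I - (I + (τ²/η_j) A_j)⁻¹` and `L = ∑ η_j P_j`. Eliminating the `y_j`, the error `z_k
= u(t_k) - v_k` satisfies `z_{k+2} = (I - L)(2 z_{k+1} - z_k) + r_k`. Each `P_j` is symmetric with
`‖P_j x‖² ≤ (P_j x, x)`, hence `0 ≤ L ≤ I`, and the energy `‖z_{k+1} - z_k‖² + (L z_{k+1}, z_{k+1})`
grows only through `r_k` (`energy_step`).

The residual has a part of size `τ^(2+λ)`, a part of size `τ² ‖z_{k+1}‖` from the Lipschitz term,
and the splitting error `τ² ∑ P_j g_j` with `∑ g_j = u''`. The last is merely `O(τ²)`, too large to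
sum over `n` steps. But `g_j` has increments `O(τ^λ)`, and the energy controls `P_j z`; summing by
parts in time moves the difference onto `g_j` and leaves boundary terms of order `τ²`
(`norm_increment_le_of_recursion`). Gronwall then gives `‖z_{k+1} - z_k‖ = O(τ^(1+λ))`, and division
by `τ` finishes.

Hölder continuity of each `A_j u` is not assumed: `A u = f - M(u) - u''` is Hölder, and `A_j A⁻¹` is
bounded by the closed graph theorem (`exists_relative_bound`). -/

/-! ### Discrete Gronwall inequality. -/

/-- Discrete Gronwall inequality in which the recursive bound on `ε K` is only available when
`ε K` dominates all previous terms. -/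
theorem le_mul_one_add_pow_of_record {ε : ℕ → ℝ} {Q b : ℝ} (hQ : 0 ≤ Q) (hb : 0 ≤ b) {N : ℕ}
    (h : ∀ K < N, ∀ q : ℕ → ℝ, Monotone q → (∀ i, 0 ≤ q i) → (∀ i < K, ε i ≤ q i) →
      (∀ i < K, ε i ≤ ε K) → ε K ≤ Q + b * ∑ i ∈ Finset.range K, q i) :
    ∀ K < N, ε K ≤ Q * (1 + b) ^ K := by
  have hmono : Monotone fun i : ℕ => Q * (1 + b) ^ i := fun i j hij =>
    mul_le_mul_of_nonneg_left (pow_le_pow_right₀ (by linarith) hij) hQ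
  have hgeom : ∀ K : ℕ, Q + b * ∑ i ∈ Finset.range K, Q * (1 + b) ^ i = Q * (1 + b) ^ K := by
    intro K
    induction K with
    | zero => simp
    | succ K ih => rw [Finset.sum_range_succ, mul_add, ← add_assoc, ih]; ring
  intro K
  induction K using Nat.strong_induction_on with
  | _ K ih =>
    intro hK
    -- A failure at `K` makes `ε K` exceed all earlier terms, so the restricted hypothesis applies
    -- there.
    by_contra! hlt
    have hprev : ∀ i < K, ε i ≤ Q * (1 + b) ^ i := fun i hi => ih i hi (hi.trans hK)
    have := h K hK _ hmono (fun i => by positivity) hprev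
      fun i hi => ((hprev i hi).trans (hmono hi.le)).trans hlt.le
    rw [hgeom] at this
    exact absurd this (not_le.2 hlt)

/-! ### Energy stability of the error recursion. -/

section Stability

variable {E : Type*} [NormedAddCommGroup E] [InnerProductSpace ℝ E]

/-- Energy inequality for one step of the recursion `z₂ = (I - L) (2 z₁ - z₀) + r` with
`0 ≤ L ≤ I`. -/
theorem energy_step {L : E →ₗ[ℝ] E} (hsymm : ∀ x y, inner ℝ (L x) y = inner ℝ x (L y))
    (hnonneg : ∀ x, 0 ≤ inner ℝ (L x) x) (hle : ∀ x, inner ℝ (L x) x ≤ ‖x‖ ^ 2)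
    {z₀ z₁ z₂ r : E} (hz : z₂ = (2 : ℝ) • z₁ - z₀ - L ((2 : ℝ) • z₁ - z₀) + r) :
    ‖z₂ - z₁‖ ^ 2 + inner ℝ (L z₂) z₂ ≤
      ‖z₁ - z₀‖ ^ 2 + inner ℝ (L z₁) z₁ + 2 * inner ℝ r (z₂ - z₁) := by
  -- In these variables the left side minus the right side equals `-(‖q‖² - (L q, q)) - (L d, d)`.
  set w := (2 : ℝ) • z₁ - z₀ with hw
  set q := L w - r with hq
  set d := z₁ - z₀ with hd
  have h2 : z₂ = w - q := by rw [hz, hq]; abel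
  have h1 : z₁ = w - d := by rw [hw, hd, two_smul]; abel
  have hr : r = L w - q := by rw [hq]; abel
  have e21 : z₂ - z₁ = d - q := by rw [h2, h1]; abel
  have hqq := hle q
  have hdd := hnonneg d
  have c1 : inner ℝ (L q) w = inner ℝ (L w) q := by rw [hsymm, real_inner_comm]
  have c2 : inner ℝ (L d) w = inner ℝ (L w) d := by rw [hsymm, real_inner_comm]
  have c3 : inner ℝ q d = inner ℝ d q := real_inner_comm _ _
  rw [e21, h2, h1, hr]
  simp only [map_sub, inner_sub_left, inner_sub_right, ← real_inner_self_eq_norm_sq] at *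
  linarith

/-- Stability of the recursion `z (k+2) = (I - ∑ η_j P_j) (2 z (k+1) - z k) + r k`, where the
forcing `r k` splits into a part `∑ P_j g_j` with small increments in time and a part which is
small up to a multiple of `z`. -/
theorem norm_increment_le_of_recursion {ι : Type*} [Fintype ι] {P : ι → E →ₗ[ℝ] E}
    (hsymm : ∀ j x y, inner ℝ (P j x) y = inner ℝ x (P j y))
    (hfirm : ∀ j x, ‖P j x‖ ^ 2 ≤ inner ℝ (P j x) x)
    {η : ι → ℝ} (hη0 : ∀ j, 0 < η j) (hη1 : ∀ j, η j ≤ 1) (hη : ∑ j, η j = 1)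
    {z : ℕ → E} {n : ℕ} {g : ℕ → ι → E} {ρ : ℕ → E} {G γ R B : ℝ} (hR : 0 ≤ R) (hB : 0 ≤ B)
    (hγ : 0 ≤ γ) (hG : 0 ≤ G)
    (hz0 : z 0 = 0)
    (hz : ∀ k, k + 1 < n → z (k + 2) = (2 : ℝ) • z (k + 1) - z k
      - (∑ j, η j • P j) ((2 : ℝ) • z (k + 1) - z k) + (ρ k + ∑ j, P j (g k j)))
    (hg : ∀ k < n, ∀ j, ‖g k j‖ ≤ G) (hgγ : ∀ k, k + 1 < n → ∀ j, ‖g (k + 1) j - g k j‖ ≤ γ)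
    (hρ : ∀ k, k + 1 < n → ‖ρ k‖ ≤ R + B * ‖z (k + 1)‖) :
    ∀ k < n, ‖z (k + 1) - z k‖ ≤
      (4 * (∑ j, (η j)⁻¹) * G + 2 * ‖z 1‖ + 2 * n * (R + (∑ j, (η j)⁻¹) * γ)) *
        (1 + 2 * n * B) ^ k := by
  set L : E →ₗ[ℝ] E := ∑ j, η j • P j with hL
  set κ : ℝ := ∑ j, (η j)⁻¹ with hκ
  have hκ0 : 0 ≤ κ := Finset.sum_nonneg fun j _ => (inv_pos.2 (hη0 j)).le
  have hLin : ∀ x y, inner ℝ (L x) y = ∑ j, η j * inner ℝ (P j x) y := by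
    intro x y
    simp [hL, sum_inner, real_inner_smul_left]
  have hPnonneg : ∀ j x, 0 ≤ inner ℝ (P j x) x := fun j x => (sq_nonneg _).trans (hfirm j x)
  have hPle : ∀ j x, inner ℝ (P j x) x ≤ ‖x‖ ^ 2 := by
    intro j x
    have h1 := real_inner_le_norm (P j x) x
    have h2 := hfirm j x
    nlinarith [sq_nonneg (‖P j x‖ - ‖x‖), sq_nonneg (‖P j x‖)]
  have hLsymm : ∀ x y, inner ℝ (L x) y = inner ℝ x (L y) := by
    intro x y
    rw [hLin, real_inner_comm (L y) x, hLin]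
    refine Finset.sum_congr rfl fun j _ => ?_
    rw [hsymm, real_inner_comm]
  have hLnonneg : ∀ x, 0 ≤ inner ℝ (L x) x := fun x => by
    rw [hLin]
    exact Finset.sum_nonneg fun j _ => mul_nonneg (hη0 j).le (hPnonneg j x)
  have hLle : ∀ x, inner ℝ (L x) x ≤ ‖x‖ ^ 2 := fun x => by
    rw [hLin]
    calc ∑ j, η j * inner ℝ (P j x) x ≤ ∑ j, η j * ‖x‖ ^ 2 :=
          Finset.sum_le_sum fun j _ => mul_le_mul_of_nonneg_left (hPle j x) (hη0 j).le
      _ = ‖x‖ ^ 2 := by rw [← Finset.sum_mul, hη, one_mul]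
  set e : ℕ → ℝ := fun k => ‖z (k + 1) - z k‖ ^ 2 + inner ℝ (L (z (k + 1))) (z (k + 1)) with he
  have he0 : ∀ k, 0 ≤ e k := fun k => add_nonneg (sq_nonneg _) (hLnonneg _)
  set ε : ℕ → ℝ := fun k => √(e k) with hε
  have hε0 : ∀ k, 0 ≤ ε k := fun k => Real.sqrt_nonneg _
  have hεsq : ∀ k, ε k ^ 2 = e k := fun k => Real.sq_sqrt (he0 k)
  have hdε : ∀ k, ‖z (k + 1) - z k‖ ≤ ε k := fun k =>
    Real.le_sqrt_of_sq_le (le_add_of_nonneg_right (hLnonneg _))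
  -- `η_j² ‖P_j z‖² ≤ η_j (P_j z, z) ≤ (L z, z)`, where the first bound uses `η_j ≤ 1`.
  have hPε : ∀ j k, ‖P j (z (k + 1))‖ ≤ (η j)⁻¹ * ε k := by
    intro j k
    rw [← div_eq_inv_mul, le_div_iff₀ (hη0 j)]
    refine Real.le_sqrt_of_sq_le ?_
    have h1 : η j * inner ℝ (P j (z (k + 1))) (z (k + 1)) ≤ inner ℝ (L (z (k + 1))) (z (k + 1)) := by
      rw [hLin]
      exact Finset.single_le_sum (f := fun j => η j * inner ℝ (P j (z (k + 1))) (z (k + 1)))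
        (fun i _ => mul_nonneg (hη0 i).le (hPnonneg i _)) (Finset.mem_univ j)
    have h2 := hfirm j (z (k + 1))
    calc (‖P j (z (k + 1))‖ * η j) ^ 2 = η j * (η j * ‖P j (z (k + 1))‖ ^ 2) := by ring
      _ ≤ 1 * (η j * inner ℝ (P j (z (k + 1))) (z (k + 1))) := by
          have := hη0 j
          gcongr
          exact hη1 j
      _ ≤ e k := by
          rw [one_mul]
          exact h1.trans (le_add_of_nonneg_left (sq_nonneg _))
  have hforce : ∀ (p : ι → E) (C : ℝ), 0 ≤ C → (∀ j, ‖p j‖ ≤ C) → ∀ k,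
      |inner ℝ (∑ j, P j (p j)) (z (k + 1))| ≤ κ * C * ε k := by
    intro p C hC hp k
    rw [sum_inner]
    calc |∑ j, inner ℝ (P j (p j)) (z (k + 1))| ≤ ∑ j, |inner ℝ (P j (p j)) (z (k + 1))| :=
          Finset.abs_sum_le_sum_abs _ _
      _ ≤ ∑ j, (η j)⁻¹ * (C * ε k) := by
          refine Finset.sum_le_sum fun j _ => ?_
          rw [hsymm]
          calc _ ≤ ‖p j‖ * ‖P j (z (k + 1))‖ := abs_real_inner_le_norm _ _
            _ ≤ C * ((η j)⁻¹ * ε k) := mul_le_mul (hp j) (hPε j k) (norm_nonneg _) hC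
            _ = _ := by ring
      _ = κ * C * ε k := by rw [← Finset.sum_mul, hκ]; ring
  have hzsum : ∀ k, ‖z (k + 1)‖ ≤ ∑ i ∈ Finset.range (k + 1), ε i := by
    intro k
    have : z (k + 1) = ∑ i ∈ Finset.range (k + 1), (z (i + 1) - z i) := by
      rw [Finset.sum_range_sub, hz0, sub_zero]
    rw [this]
    exact norm_sum_le_of_le _ fun i _ => hdε i
  -- Summation by parts: subtracting this boundary term leaves only increments of `g` in the
  -- one-step inequality.
  set F : ℕ → ℝ := fun k => e k - 2 * inner ℝ (∑ j, P j (g k j)) (z (k + 1)) with hF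
  have hFstep : ∀ k, k + 1 < n → F (k + 1) ≤ F k + 2 * ε (k + 1) * (R + κ * γ + B * ‖z (k + 1)‖) := by
    intro k hk
    have h1 := energy_step hLsymm hLnonneg hLle (hz k hk)
    have h2 : inner ℝ (ρ k) (z (k + 2) - z (k + 1)) ≤ (R + B * ‖z (k + 1)‖) * ε (k + 1) :=
      (real_inner_le_norm _ _).trans
        (mul_le_mul (hρ k hk) (hdε (k + 1)) (norm_nonneg _) (by positivity))
    have h3 := (abs_le.1 (hforce (fun j => g (k + 1) j - g k j) γ hγ (hgγ k hk) (k + 1))).1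
    simp only [map_sub, Finset.sum_sub_distrib] at h3
    rw [inner_sub_left] at h3
    rw [inner_add_left, inner_sub_right (∑ j, P j (g k j))] at h1
    simp only [hF, he]
    have e1 : k + 1 + 1 = k + 2 := rfl
    rw [e1] at h3 ⊢
    nlinarith
  have hFsum : ∀ K < n, F K ≤ F 0 +
      ∑ k ∈ Finset.range K, 2 * ε (k + 1) * (R + κ * γ + B * ‖z (k + 1)‖) := by
    intro K
    induction K with
    | zero => simp
    | succ K ih =>
      intro hK
      rw [Finset.sum_range_succ]
      linarith [hFstep K hK, ih (by omega)]
  have hε_first : ε 0 ≤ 2 * ‖z 1‖ := by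
    refine Real.sqrt_le_iff.2 ⟨by positivity, ?_⟩
    have := hLle (z 1)
    simp only [he, hz0, zero_add, sub_zero]
    nlinarith [sq_nonneg ‖z 1‖]
  intro k hk
  refine (hdε k).trans ?_
  refine le_mul_one_add_pow_of_record (N := n) (by positivity) (by positivity) ?_ k hk
  intro K hK q hqmono hq0 hεq hrec
  -- The estimate is quadratic in `ε`; at a record every `ε i` is at most `ε K`, so one factor `ε K`
  -- can be divided out.
  rcases (hε0 K).eq_or_lt with h0 | hpos
  · rw [← h0]
    have : 0 ≤ ∑ i ∈ Finset.range K, q i := Finset.sum_nonneg fun i _ => hq0 i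
    positivity
  have hrec' : ∀ i ≤ K, ε i ≤ ε K := fun i hi => by
    rcases hi.eq_or_lt with rfl | h
    · exact le_rfl
    · exact hrec i h
  have hn : 0 < n := by omega
  have hsum : ∑ k ∈ Finset.range K, 2 * ε (k + 1) * (R + κ * γ + B * ‖z (k + 1)‖) ≤
      2 * ε K * (n * (R + κ * γ) + n * B * ∑ i ∈ Finset.range K, q i) := by
    have hterm : ∀ k ∈ Finset.range K, 2 * ε (k + 1) * (R + κ * γ + B * ‖z (k + 1)‖) ≤
        2 * ε K * (R + κ * γ + B * (n * q k)) := by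
      intro k hk
      have hk' : k < K := Finset.mem_range.1 hk
      have hzq : ‖z (k + 1)‖ ≤ n * q k := by
        refine (hzsum k).trans ?_
        calc ∑ i ∈ Finset.range (k + 1), ε i ≤ ∑ i ∈ Finset.range (k + 1), q k := by
              refine Finset.sum_le_sum fun i hi => ?_
              have hik : i ≤ k := Nat.lt_succ_iff.1 (Finset.mem_range.1 hi)
              exact (hεq i (by omega)).trans (hqmono hik)
          _ = ((k + 1 : ℕ) : ℝ) * q k := by simp
          _ ≤ n * q k := by
              refine mul_le_mul_of_nonneg_right ?_ (hq0 k)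
              exact_mod_cast (by omega : k + 1 ≤ n)
      have := hrec' (k + 1) (by omega)
      have := hε0 K
      have : 0 ≤ R + κ * γ := by positivity
      gcongr
    refine (Finset.sum_le_sum hterm).trans ?_
    rw [← Finset.mul_sum, Finset.sum_add_distrib]
    have hKn : ((K : ℕ) : ℝ) ≤ n := by exact_mod_cast hK.le
    have h1 : ∑ k ∈ Finset.range K, (R + κ * γ) ≤ n * (R + κ * γ) := by
      rw [Finset.sum_const, Finset.card_range, nsmul_eq_mul]
      exact mul_le_mul_of_nonneg_right hKn (by positivity)
    have h2 : ∑ k ∈ Finset.range K, B * (n * q k) = n * B * ∑ i ∈ Finset.range K, q i := by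
      rw [Finset.mul_sum]
      exact Finset.sum_congr rfl fun i _ => by ring
    rw [h2]
    gcongr
  have hmain := hFsum K hK
  have hFK := (abs_le.1 (hforce (g K) G hG (hg K hK) K)).2
  have hF0 := (abs_le.1 (hforce (g 0) G hG (hg 0 hn) 0)).1
  simp only [hF] at hmain
  rw [← hεsq K, ← hεsq 0] at hmain
  have h00 : ε 0 ^ 2 ≤ ε K * (2 * ‖z 1‖) := by
    rw [sq]
    exact mul_le_mul (hrec' 0 (by omega)) hε_first (hε0 0) hpos.le
  have h01 : κ * G * ε 0 ≤ κ * G * ε K :=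
    mul_le_mul_of_nonneg_left (hrec' 0 (by omega)) (by positivity)
  -- The boundary terms at `K` and `0` contribute `2κG` each, and `ε 0` contributes `2‖z 1‖`.
  refine le_of_mul_le_mul_left ?_ hpos
  rw [← sq]
  simp only [zero_add] at *
  nlinarith

end Stability

/-! ### Compatibility of the real and `𝕜` structures. -/

section RealScalars

variable {𝕜 H : Type*} [RCLike 𝕜] [NormedAddCommGroup H] [InnerProductSpace 𝕜 H]
  [NormedSpace ℝ H]

/-- The real structure on `H` is a separate instance, not tied to `𝕜` by assumption. The two agree
because a continuous additive map from `ℝ` is automatically real-linear. -/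
theorem real_smul_eq_ofReal_smul (r : ℝ) (x : H) : r • x = (r : 𝕜) • x := by
  let φ : ℝ →+ H :=
    { toFun := fun s => (s : 𝕜) • x
      map_zero' := by simp
      map_add' := fun s t => by rw [RCLike.ofReal_add, add_smul] }
  have hφ : Continuous φ := (RCLike.continuous_ofReal (K := 𝕜)).smul continuous_const
  have h := map_real_smul φ hφ r 1
  change (((r • (1 : ℝ) : ℝ) : 𝕜)) • x = r • (((1 : ℝ) : 𝕜) • x) at h
  rw [smul_eq_mul, mul_one, RCLike.ofReal_one, one_smul] at h
  exact h.symm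

variable (𝕜 H) in
/-- The real inner product `re ⟪x, y⟫` on a space with a given real normed space structure. -/
noncomputable abbrev InnerProductSpace.ofRCLike : InnerProductSpace ℝ H :=
  { ‹NormedSpace ℝ H› with
    inner := fun x y => RCLike.re (inner 𝕜 x y)
    norm_sq_eq_re_inner := fun x => norm_sq_eq_re_inner (𝕜 := 𝕜) x
    conj_inner_symm := fun x y => inner_re_symm (𝕜 := 𝕜) y x
    add_left := fun x y z => by rw [inner_add_left, map_add]
    smul_left := fun x y r => by
      rw [real_smul_eq_ofReal_smul (𝕜 := 𝕜), inner_smul_left, RCLike.conj_ofReal,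
        RCLike.re_ofReal_mul]
      rfl }

end RealScalars

/-! ### Resolvents, relative boundedness and sums of operators. -/

section Resolvent

variable {𝕜 H : Type*} [RCLike 𝕜] [NormedAddCommGroup H] [InnerProductSpace 𝕜 H]
  [CompleteSpace H] {A : H →ₗ.[𝕜] H} {α : ℝ}

namespace IsSelfAdjointPosDef

theorem inner_symm (hA : IsSelfAdjointPosDef A α) {u y v w : H} (hu : (u, y) ∈ A.graph)
    (hv : (v, w) ∈ A.graph) : inner 𝕜 y v = inner 𝕜 u w := by
  have h := LinearPMap.adjoint_isFormalAdjoint hA.dense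
  rw [LinearPMap.isSelfAdjoint_def.1 hA.selfAdjoint] at h
  obtain ⟨u', rfl, rfl⟩ := A.mem_graph_iff.1 hu
  obtain ⟨v', rfl, rfl⟩ := A.mem_graph_iff.1 hv
  exact h u' v'

theorem le_inner_of_mem_graph (hA : IsSelfAdjointPosDef A α) {u y : H} (hu : (u, y) ∈ A.graph) :
    α * ‖u‖ ^ 2 ≤ RCLike.re (inner 𝕜 y u) := by
  obtain ⟨u', rfl, rfl⟩ := A.mem_graph_iff.1 hu
  exact hA.le_inner u'

theorem mul_norm_le (hA : IsSelfAdjointPosDef A α) {μ : ℝ} (hμ : 0 ≤ μ) {u y : H}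
    (hu : (u, y) ∈ A.graph) : α * ‖u‖ ≤ ‖(μ : 𝕜) • u + y‖ := by
  rcases (norm_nonneg u).eq_or_lt with h0 | hpos
  · rw [← h0, mul_zero]; exact norm_nonneg _
  refine le_of_mul_le_mul_right ?_ hpos
  have h1 : RCLike.re (inner 𝕜 ((μ : 𝕜) • u + y) u) ≤ ‖(μ : 𝕜) • u + y‖ * ‖u‖ :=
    re_inner_le_norm _ _
  have h2 := hA.le_inner_of_mem_graph hu
  rw [inner_add_left, map_add, inner_smul_left, RCLike.conj_ofReal, RCLike.re_ofReal_mul,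
    ← norm_sq_eq_re_inner] at h1
  nlinarith [mul_nonneg hμ (sq_nonneg ‖u‖)]

/-- The graph is complete since `A` is closed, and coercivity makes `μ + A` bounded below in the
graph norm. -/
theorem isClosed_range_shift (hA : IsSelfAdjointPosDef A α) {μ : ℝ} (hμ : 0 ≤ μ) :
    IsClosed (range fun p : A.graph => (μ : 𝕜) • p.1.1 + p.1.2) := by
  have hcl : IsClosed (A.graph : Set (H × H)) := hA.selfAdjoint.isClosed
  have : CompleteSpace A.graph := completeSpace_coe_iff_isComplete.2 hcl.isComplete
  let Φ : A.graph →L[𝕜] H :=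
    ((μ : 𝕜) • ContinuousLinearMap.fst 𝕜 H H + ContinuousLinearMap.snd 𝕜 H H).comp
      A.graph.subtypeL
  have hanti : ∃ K, AntilipschitzWith K Φ := by
    refine ⟨⟨α⁻¹ + (1 + μ * α⁻¹), by have := hA.pos; positivity⟩,
      AddMonoidHomClass.antilipschitz_of_bound Φ fun p => ?_⟩
    have h1 : α * ‖p.1.1‖ ≤ ‖Φ p‖ := hA.mul_norm_le hμ p.2
    have h2 : ‖p.1.1‖ ≤ α⁻¹ * ‖Φ p‖ := by
      rw [← div_eq_inv_mul, le_div_iff₀ hA.pos]; linarith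
    have h3 : ‖p.1.2‖ ≤ (1 + μ * α⁻¹) * ‖Φ p‖ := by
      have e : p.1.2 = Φ p - (μ : 𝕜) • p.1.1 := by
        change p.1.2 = ((μ : 𝕜) • p.1.1 + p.1.2) - (μ : 𝕜) • p.1.1
        abel
      rw [e]
      refine (norm_sub_le _ _).trans ?_
      rw [norm_smul, RCLike.norm_ofReal, abs_of_nonneg hμ]
      nlinarith [mul_le_mul_of_nonneg_left h2 hμ]
    have hα := hA.pos
    have h4 : 0 ≤ α⁻¹ * ‖Φ p‖ := by positivity
    have h5 : 0 ≤ (1 + μ * α⁻¹) * ‖Φ p‖ := by positivity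
    change ‖p.1‖ ≤ (α⁻¹ + (1 + μ * α⁻¹)) * ‖Φ p‖
    rw [add_mul]
    exact max_le (by linarith) (by linarith)
  obtain ⟨K, hK⟩ := hanti
  exact hK.isClosed_range Φ.uniformContinuous

/-- Coercivity gives injectivity and closed range; self-adjointness gives density of the range. The
value `μ = 0` is allowed and yields `A⁻¹`. -/
theorem exists_resolvent (hA : IsSelfAdjointPosDef A α) {μ : ℝ} (hμ : 0 ≤ μ) :
    ∃ R : H →ₗ[𝕜] H, (∀ x, (R x, x - (μ : 𝕜) • R x) ∈ A.graph) ∧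
      ∀ u y, (u, y) ∈ A.graph → R ((μ : 𝕜) • u + y) = u := by
  let Φ : A.graph →ₗ[𝕜] H :=
    ((μ : 𝕜) • LinearMap.fst 𝕜 H H + LinearMap.snd 𝕜 H H) ∘ₗ A.graph.subtype
  have hΦ : ∀ p, Φ p = (μ : 𝕜) • p.1.1 + p.1.2 := fun p => rfl
  have hinj : Function.Injective Φ := by
    rw [injective_iff_map_eq_zero]
    intro p hp
    have h1 := hA.mul_norm_le hμ p.2
    rw [← hΦ, hp, norm_zero] at h1
    have h2 : p.1.1 = 0 := norm_le_zero_iff.1 (by nlinarith [hA.pos, norm_nonneg p.1.1])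
    have h3 := hΦ p
    rw [hp, h2, smul_zero, zero_add] at h3
    exact Subtype.ext (Prod.ext h2 h3.symm)
  have hsurj : Function.Surjective Φ := by
    have hcl : IsClosed (LinearMap.range Φ : Set H) := by
      rw [LinearMap.coe_range]
      exact hA.isClosed_range_shift hμ
    rw [← LinearMap.range_eq_top, ← hcl.submodule_topologicalClosure_eq,
      Submodule.topologicalClosure_eq_top_iff, Submodule.eq_bot_iff]
    intro w hw
    rw [Submodule.mem_orthogonal'] at hw
    -- A vector orthogonal to the range of `μ + A` lies in `D(A*) = D(A)` with `A w = -μ w`, so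
    -- coercivity kills it.
    have hmem : (w, -((μ : 𝕜) • w)) ∈ A.graph := by
      rw [← LinearPMap.isSelfAdjoint_def.1 hA.selfAdjoint,
        LinearPMap.adjoint_graph_eq_graph_adjoint hA.dense, Submodule.mem_adjoint_iff]
      intro u y hu
      have h := hw (Φ ⟨(u, y), hu⟩) (LinearMap.mem_range_self _ _)
      rw [hΦ, inner_add_right, inner_smul_right] at h
      have h' := congrArg (starRingEnd 𝕜) h
      rw [map_add, map_mul, RCLike.conj_ofReal, inner_conj_symm, inner_conj_symm, map_zero] at h'
      rw [inner_neg_right, inner_smul_right, sub_neg_eq_add, add_comm, h']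
    have h1 := hA.mul_norm_le hμ hmem
    rw [add_neg_cancel, norm_zero] at h1
    exact norm_le_zero_iff.1 (by nlinarith [hA.pos, norm_nonneg w])
  let e := LinearEquiv.ofBijective Φ ⟨hinj, hsurj⟩
  refine ⟨LinearMap.fst 𝕜 H H ∘ₗ A.graph.subtype ∘ₗ e.symm.toLinearMap, fun x => ?_,
    fun u y hu => ?_⟩
  · have h : Φ (e.symm x) = x := e.apply_symm_apply x
    rw [hΦ] at h
    have hx : x - (μ : 𝕜) • (e.symm x).1.1 = (e.symm x).1.2 := by
      nth_rewrite 1 [← h]; abel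
    change ((e.symm x).1.1, x - (μ : 𝕜) • (e.symm x).1.1) ∈ A.graph
    rw [hx]
    exact (e.symm x).2
  · have h : e.symm ((μ : 𝕜) • u + y) = ⟨(u, y), hu⟩ := e.symm_apply_apply ⟨(u, y), hu⟩
    change (e.symm ((μ : 𝕜) • u + y)).1.1 = u
    rw [h]

/-- If `D(A) ⊆ D(B)`, then `B` is bounded relative to `A`. -/
theorem exists_relative_bound (hA : IsSelfAdjointPosDef A α) {B : H →ₗ.[𝕜] H} (hB : B.IsClosed)
    (hAB : A.domain ≤ B.domain) :
    ∃ C : ℝ, 0 ≤ C ∧ ∀ u y w, (u, y) ∈ A.graph → (u, w) ∈ B.graph → ‖w‖ ≤ C * ‖y‖ := by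
  obtain ⟨R, hR, hRinv⟩ := hA.exists_resolvent (μ := 0) le_rfl
  simp only [RCLike.ofReal_zero, zero_smul, sub_zero, zero_add] at hR hRinv
  have hdom : ∀ x, R x ∈ B.domain := fun x => hAB (LinearPMap.mem_domain_of_mem_graph (hR x))
  let g : H →ₗ[𝕜] H := B.toFun ∘ₗ R.codRestrict B.domain hdom
  have hg : ∀ x, (R x, g x) ∈ B.graph := fun x => B.mem_graph ⟨R x, hdom x⟩
  have hRcont : Continuous R := by
    refine AddMonoidHomClass.continuous_of_bound R α⁻¹ fun x => ?_
    have := hA.mul_norm_le le_rfl (hR x)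
    rw [RCLike.ofReal_zero, zero_smul, zero_add] at this
    rw [← div_eq_inv_mul, le_div_iff₀ hA.pos]
    linarith
  -- Closed graph theorem for `g = B A⁻¹`, which is everywhere defined.
  have hgcont : Continuous g := by
    refine g.continuous_of_seq_closed_graph fun s x y hs hgs => ?_
    have hlim : Filter.Tendsto (fun n => (R (s n), g (s n))) Filter.atTop (nhds (R x, y)) :=
      ((hRcont.tendsto x).comp hs).prodMk_nhds hgs
    have hmem : (R x, y) ∈ B.graph :=
      IsClosed.mem_of_tendsto hB hlim (Filter.Eventually.of_forall fun n => hg (s n))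
    exact B.mem_graph_snd_inj hmem (hg x) rfl
  let G : H →L[𝕜] H := ⟨g, hgcont⟩
  refine ⟨‖G‖, norm_nonneg _, fun u y w hu hw => ?_⟩
  have h1 := hg y
  rw [hRinv u y hu] at h1
  rw [B.mem_graph_snd_inj hw h1 rfl]
  exact G.le_opNorm y

end IsSelfAdjointPosDef

/-- The operator `P = I - (I + c A)⁻¹`. -/
theorem IsSelfAdjointPosDef.exists_one_sub_resolvent [NormedSpace ℝ H]
    (hA : IsSelfAdjointPosDef A α) {c : ℝ} (hc : 0 < c) :
    ∃ P : H →ₗ[ℝ] H,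
      (∀ x y, RCLike.re (inner 𝕜 (P x) y) = RCLike.re (inner 𝕜 x (P y))) ∧
      (∀ x, ‖P x‖ ^ 2 ≤ RCLike.re (inner 𝕜 (P x) x)) ∧
      (∀ u y, (u, y) ∈ A.graph → P u = c • (y - P y)) ∧
      ∀ u y, (u, y) ∈ A.graph → P (u + c • y) = c • y := by
  have hμ : 0 < c⁻¹ := inv_pos.2 hc
  obtain ⟨R, hR, hRinv⟩ := hA.exists_resolvent hμ.le
  simp only [← real_smul_eq_ofReal_smul] at hR hRinv
  let P : H →ₗ[ℝ] H :=
    { toFun := fun x => x - c⁻¹ • R x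
      map_add' := fun x y => by rw [map_add, smul_add]; abel
      map_smul' := fun r x => by
        rw [real_smul_eq_ofReal_smul (𝕜 := 𝕜) r x, map_smul, ← real_smul_eq_ofReal_smul,
          ← real_smul_eq_ofReal_smul, RingHom.id_apply, smul_sub, smul_comm] }
  have hP : ∀ x, P x = x - c⁻¹ • R x := fun x => rfl
  -- With `R = (c⁻¹ + A)⁻¹` this says `P = A R`; positivity of `(A R x, R x)` then gives the firm
  -- bound through `x = c⁻¹ R x + P x`.
  have hPR : ∀ x, (R x, P x) ∈ A.graph := hR
  have hx : ∀ x, x = c⁻¹ • R x + P x := fun x => by rw [hP]; abel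
  refine ⟨P, fun x y => ?_, fun x => ?_, fun u y hu => ?_, fun u y hu => ?_⟩
  · nth_rewrite 1 [hx y]
    nth_rewrite 2 [hx x]
    rw [inner_add_left, inner_add_right, real_smul_eq_ofReal_smul (𝕜 := 𝕜),
      real_smul_eq_ofReal_smul (𝕜 := 𝕜), inner_smul_left, inner_smul_right, RCLike.conj_ofReal,
      hA.inner_symm (hPR x) (hPR y)]
  · nth_rewrite 3 [hx x]
    rw [inner_add_right, real_smul_eq_ofReal_smul (𝕜 := 𝕜), inner_smul_right, map_add,
      RCLike.re_ofReal_mul, ← norm_sq_eq_re_inner]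
    have := hA.le_inner_of_mem_graph (hPR x)
    have h0 : 0 ≤ RCLike.re (inner 𝕜 (P x) (R x)) :=
      le_trans (mul_nonneg hA.pos.le (sq_nonneg _)) this
    have := mul_nonneg hμ.le h0
    linarith
  · have h := hRinv u y hu
    rw [map_add, real_smul_eq_ofReal_smul (𝕜 := 𝕜), map_smul, ← real_smul_eq_ofReal_smul] at h
    rw [hP y, sub_sub_cancel, smul_smul, mul_inv_cancel₀ hc.ne', one_smul, hP, sub_eq_iff_eq_add',
      h]
  · have h : R (u + c • y) = c • u := by
      have e : u + c • y = (c : 𝕜) • (c⁻¹ • u + y) := by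
        rw [← real_smul_eq_ofReal_smul, smul_add, smul_smul, mul_inv_cancel₀ hc.ne', one_smul]
      rw [e, map_smul, hRinv u y hu, ← real_smul_eq_ofReal_smul]
    rw [hP, h, smul_smul, inv_mul_cancel₀ hc.ne', one_smul, add_sub_cancel_left]

theorem LinearPMap.exists_graph_of_mem_graph_sum {R E F ι : Type*} [Ring R] [AddCommGroup E]
    [Module R E] [AddCommGroup F] [Module R F] (B : ι → E →ₗ.[R] F)
    (s : Finset ι) {u : E} {y : F} (h : (u, y) ∈ (∑ j ∈ s, B j).graph) :
    ∃ w : ι → F, (∀ j ∈ s, (u, w j) ∈ (B j).graph) ∧ y = ∑ j ∈ s, w j := by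
  classical
  induction s using Finset.induction_on generalizing y with
  | empty =>
    obtain ⟨u', rfl, rfl⟩ := LinearPMap.mem_graph_iff _ |>.1 h
    exact ⟨0, by simp, rfl⟩
  | insert i s hi ih =>
    rw [Finset.sum_insert hi] at h
    obtain ⟨u', rfl, rfl⟩ := LinearPMap.mem_graph_iff _ |>.1 h
    obtain ⟨hu1, hu2⟩ := u'.2
    obtain ⟨w, hw, hsum⟩ := ih (LinearPMap.mem_graph (∑ j ∈ s, B j) ⟨u', hu2⟩)
    refine ⟨Function.update w i (B i ⟨u', hu1⟩), fun j hj => ?_, ?_⟩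
    · rcases eq_or_ne j i with rfl | hne
      · rw [Function.update_self]
        exact LinearPMap.mem_graph (B j) ⟨u', hu1⟩
      · rw [Function.update_of_ne hne]
        exact hw j ((Finset.mem_insert.1 hj).resolve_left hne)
    · rw [Finset.sum_insert hi, Function.update_self,
        Finset.sum_update_of_notMem hi, ← hsum]
      rfl

end Resolvent

/-! ### Taylor estimates, local error and regularity of the exact solution. -/

/-- Second-order Taylor estimate for a twice differentiable function whose second derivative has
modulus of continuity `ω` along the segment. -/
theorem norm_taylor_two_le {E : Type*} [NormedAddCommGroup E] [NormedSpace ℝ E] {I : Set ℝ}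
    (hI : Convex ℝ I) {u u' u'' : ℝ → E} (h1 : ∀ x ∈ I, HasDerivWithinAt u (u' x) I x)
    (h2 : ∀ x ∈ I, HasDerivWithinAt u' (u'' x) I x) {s t ω : ℝ} (ht : t ∈ I) (hs : s ∈ I)
    {p : E} (hω : ∀ x ∈ segment ℝ t s, ‖u'' x - p‖ ≤ ω) :
    ‖u s - u t - (s - t) • u' t - ((s - t) ^ 2 / 2) • p‖ ≤ ω * |s - t| ^ 2 := by
  have hsub : segment ℝ t s ⊆ I := hI.segment_subset ht hs
  have hω0 : 0 ≤ ω := (norm_nonneg _).trans (hω t (left_mem_segment ℝ t s))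
  -- The mean value inequality is applied first to `u' - y • p`, then to `u` minus its quadratic
  -- model; the factor `1/2` is given up.
  have hfirst : ∀ x ∈ segment ℝ t s, ‖u' x - u' t - (x - t) • p‖ ≤ ω * |s - t| := by
    intro x hx
    have hsubx : segment ℝ t x ⊆ segment ℝ t s :=
      (convex_segment t s).segment_subset (left_mem_segment ℝ t s) hx
    have h := (convex_segment (𝕜 := ℝ) t x).norm_image_sub_le_of_norm_hasDerivWithin_le
      (f := fun y => u' y - y • p) (f' := fun y => u'' y - (1 : ℝ) • p) (C := ω)
      (fun y hy => ((h2 y (hsub (hsubx hy))).mono (hsubx.trans hsub)).sub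
        ((hasDerivWithinAt_id y _).smul_const p))
      (fun y hy => by rw [one_smul]; exact hω y (hsubx hy))
      (left_mem_segment ℝ t x) (right_mem_segment ℝ t x)
    have e : u' x - u' t - (x - t) • p = u' x - x • p - (u' t - t • p) := by
      rw [sub_smul]; abel
    rw [e]
    refine h.trans (mul_le_mul_of_nonneg_left ?_ hω0)
    rw [segment_eq_uIcc] at hx
    rw [Real.norm_eq_abs]
    exact abs_sub_left_of_mem_uIcc hx
  have h := (convex_segment (𝕜 := ℝ) t s).norm_image_sub_le_of_norm_hasDerivWithin_le
    (f := fun y => u y - y • u' t - ((y - t) ^ 2 / 2) • p)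
    (f' := fun y => u' y - (1 : ℝ) • u' t - (y - t) • p) (C := ω * |s - t|)
    (fun y hy => by
      refine (((h1 y (hsub hy)).mono hsub).sub
        ((hasDerivWithinAt_id y _).smul_const (u' t))).sub (HasDerivWithinAt.smul_const ?_ p)
      have := ((((hasDerivWithinAt_id y (segment ℝ t s)).sub_const t).pow 2).div_const 2)
      convert this using 1 <;> simp)
    (fun y hy => by rw [one_smul]; exact hfirst y hy)
    (left_mem_segment ℝ t s) (right_mem_segment ℝ t s)
  have e : u s - u t - (s - t) • u' t - ((s - t) ^ 2 / 2) • p =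
      u s - s • u' t - ((s - t) ^ 2 / 2) • p - (u t - t • u' t - ((t - t) ^ 2 / 2) • p) := by
    rw [sub_smul, sub_self]; simp only [ne_eq, OfNat.ofNat_ne_zero, not_false_eq_true, zero_pow,
      zero_div, zero_smul, sub_zero]; abel
  rw [e, sq |s - t|, ← mul_assoc]
  simpa [Real.norm_eq_abs] using h

/-- Error recursion for one step of the decomposition scheme: `u₂`, `v₂` are the new values of the
exact and the approximate solution, and `wu`, `wv` their extrapolations. -/
theorem decomposition_step_error {ι E : Type*} [Fintype ι] [AddCommGroup E] [Module ℝ E]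
    {P : ι → E →ₗ[ℝ] E} {η : ι → ℝ} (hη : ∑ j, η j = 1) {τ : ℝ} {wu wv u₂ v₂ e : E}
    {a b y Gu Gv : ι → E}
    (hu : ∀ j, η j • P j wu = τ ^ 2 • (a j + b j - P j (a j + b j)))
    (hv : ∀ j, η j • y j = η j • wv - η j • P j wv + τ ^ 2 • (Gv j - P j (Gv j)))
    (hu₂ : u₂ = wu + τ ^ 2 • ∑ j, (Gu j - a j) + e) (hv₂ : v₂ = ∑ j, η j • y j) :
    u₂ - v₂ = wu - wv - (∑ j, η j • P j) (wu - wv) +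
      (e + τ ^ 2 • ∑ j, ((Gu j - Gv j - P j (Gu j - Gv j)) + (b j - P j (b j))) +
        ∑ j, P j (τ ^ 2 • (Gu j - a j))) := by
  have hwv : ∑ j, η j • wv = wv := by rw [← Finset.sum_smul, hη, one_smul]
  rw [hu₂, hv₂, map_sub]
  simp only [LinearMap.sum_apply, LinearMap.smul_apply]
  simp only [hu, hv]
  simp only [map_sub, map_add, map_smul, Finset.sum_add_distrib, Finset.sum_sub_distrib,
    ← Finset.smul_sum, smul_add, smul_sub, hwv]
  abel

theorem norm_sub_apply_le_of_firm {E : Type*} [NormedAddCommGroup E] [InnerProductSpace ℝ E]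
    {x p : E} (h : ‖p‖ ^ 2 ≤ inner ℝ p x) : ‖x - p‖ ≤ ‖x‖ := by
  refine (sq_le_sq₀ (norm_nonneg _) (norm_nonneg _)).1 ?_
  rw [norm_sub_sq_real, real_inner_comm]
  nlinarith [sq_nonneg ‖p‖]

/-- Converts errors of first order, such as `τ` itself, into errors of order `τ^λ`. -/
theorem abs_sub_le_mul_rpow {T s t l : ℝ} (hT : 0 < T) (hl1 : l ≤ 1)
    (h : |t - s| ≤ T) : |t - s| ≤ T ^ (1 - l) * |t - s| ^ l := by
  rcases (abs_nonneg (t - s)).eq_or_lt with h0 | hpos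
  · rw [← h0]
    exact mul_nonneg (Real.rpow_nonneg hT.le _) (Real.rpow_nonneg le_rfl _)
  calc |t - s| = |t - s| ^ (1 - l) * |t - s| ^ l := by
        rw [← Real.rpow_add hpos, sub_add_cancel, Real.rpow_one]
    _ ≤ _ := by
        have : 0 ≤ 1 - l := by linarith
        gcongr

theorem abs_sub_le_of_mem_Icc_zero {T s t : ℝ} (hs : s ∈ Icc 0 T) (ht : t ∈ Icc 0 T) :
    |t - s| ≤ T := by
  rw [abs_le]
  exact ⟨by linarith [hs.2, ht.1], by linarith [hs.1, ht.2]⟩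

/-- A solution of the Cauchy problem splits along the operators `A_j`, with Hölder continuous
components, and satisfies Taylor estimates. -/
theorem IsCauchySolution.exists_estimates {𝕜 H : Type*} [RCLike 𝕜] [NormedAddCommGroup H]
    [InnerProductSpace 𝕜 H] [NormedSpace ℝ H] [CompleteSpace H]
    {A : H →ₗ.[𝕜] H} {α : ℝ} (hA : IsSelfAdjointPosDef A α)
    {m : ℕ} {Aj : Fin m → (H →ₗ.[𝕜] H)} {αj : Fin m → ℝ}
    (hAj : ∀ j, IsSelfAdjointPosDef (Aj j) (αj j)) (hsum : A = ∑ j, Aj j)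
    {M : H → H} {L : NNReal} (hM : LipschitzWith L M)
    {T : ℝ} (hT : 0 < T) {f : ℝ → H} {φ₀ φ₁ : H}
    {u : ℝ → H} (hu : IsCauchySolution A M f φ₀ φ₁ T u)
    {lam : NNReal} (hlam0 : 0 < lam) (hlam1 : lam ≤ 1)
    (hfH : ∃ C : NNReal, HolderOnWith C lam f (Icc 0 T))
    (huH : ∃ C : NNReal, HolderOnWith C lam (iteratedDerivWithin 2 u (Icc 0 T)) (Icc 0 T)) :
    ∃ (K : ℝ) (a : ℝ → Fin m → H), 0 ≤ K ∧
      (∀ t ∈ Icc 0 T, ∀ j, (u t, a t j) ∈ (Aj j).graph) ∧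
      (∀ t ∈ Icc 0 T, iteratedDerivWithin 2 u (Icc 0 T) t = f t - M (u t) - ∑ j, a t j) ∧
      (∀ t ∈ Icc 0 T, ∀ s ∈ Icc 0 T, ∀ j, ‖a t j - a s j‖ ≤ K * |t - s| ^ (lam : ℝ)) ∧
      (∀ t ∈ Icc 0 T, ∀ j, ‖a t j‖ ≤ K) ∧
      (∀ t ∈ Icc 0 T, ∀ s ∈ Icc 0 T,
        ‖(f t - M (u t)) - (f s - M (u s))‖ ≤ K * |t - s| ^ (lam : ℝ)) ∧
      (∀ t ∈ Icc 0 T, ‖f t - M (u t)‖ ≤ K) ∧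
      (∀ t ∈ Icc 0 T, ∀ s ∈ Icc 0 T,
        ‖u s - u t - (s - t) • derivWithin u (Icc 0 T) t -
          ((s - t) ^ 2 / 2) • iteratedDerivWithin 2 u (Icc 0 T) t‖ ≤
            K * |s - t| ^ (lam : ℝ) * |s - t| ^ 2) ∧
      (∀ t ∈ Icc 0 T, ∀ s ∈ Icc 0 T,
        ‖u s - u t - (s - t) • derivWithin u (Icc 0 T) t‖ ≤ K * |s - t| ^ 2) := by
  obtain ⟨Cf, hCf⟩ := hfH
  obtain ⟨Cu, hCu⟩ := huH
  set I : Set ℝ := Icc 0 T with hI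
  set u' := derivWithin u I with hu'
  set u'' := iteratedDerivWithin 2 u I with hu''
  have hlam1' : (lam : ℝ) ≤ 1 := by exact_mod_cast hlam1
  have huniq : UniqueDiffOn ℝ I := uniqueDiffOn_Icc hT
  have hd1 : ∀ x ∈ I, HasDerivWithinAt u (u' x) I x := fun x hx =>
    ((hu.contDiffOn.differentiableOn (by norm_num)) x hx).hasDerivWithinAt
  have hd2 : ∀ x ∈ I, HasDerivWithinAt u' (u'' x) I x := by
    intro x hx
    have h := hu.contDiffOn.differentiableOn_iteratedDerivWithin (m := 1) (by norm_num) huniq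
    have e1 : iteratedDerivWithin 1 u I = u' := by rw [iteratedDerivWithin_one]
    have e2 : u'' x = derivWithin (iteratedDerivWithin 1 u I) I x := by
      rw [hu'', iteratedDerivWithin_succ]
    rw [e1] at h e2
    rw [e2]
    exact (h x hx).hasDerivWithinAt
  have hu''cont : ContinuousOn u'' I :=
    hu.contDiffOn.continuousOn_iteratedDerivWithin (by norm_num) huniq
  have hu'cont : ContinuousOn u' I := fun x hx => (hd2 x hx).continuousWithinAt
  have hfcont : ContinuousOn f I := hCf.continuousOn hlam0
  obtain ⟨D₁, hD₁⟩ := isCompact_Icc.exists_bound_of_continuousOn hu'cont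
  obtain ⟨D₂, hD₂⟩ := isCompact_Icc.exists_bound_of_continuousOn hu''cont
  obtain ⟨Q, hQ⟩ := isCompact_Icc.exists_bound_of_continuousOn
    (hfcont.sub hu.continuousOn_nonlinear)
  have h0I : (0 : ℝ) ∈ I := ⟨le_rfl, hT.le⟩
  have hD₁0 : 0 ≤ D₁ := (norm_nonneg _).trans (hD₁ 0 h0I)
  have hD₂0 : 0 ≤ D₂ := (norm_nonneg _).trans (hD₂ 0 h0I)
  have hQ0 : 0 ≤ Q := (norm_nonneg _).trans (hQ 0 h0I)
  have hulip : ∀ t ∈ I, ∀ s ∈ I, ‖u t - u s‖ ≤ D₁ * T ^ (1 - (lam : ℝ)) * |t - s| ^ (lam : ℝ) := by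
    intro t ht s hs
    have h1 := (convex_Icc 0 T).norm_image_sub_le_of_norm_hasDerivWithin_le hd1 hD₁ hs ht
    rw [Real.norm_eq_abs] at h1
    have h2 := abs_sub_le_mul_rpow hT hlam1' (abs_sub_le_of_mem_Icc_zero hs ht)
    rw [mul_assoc]
    exact h1.trans (mul_le_mul_of_nonneg_left h2 hD₁0)
  set Kq : ℝ := Cf + L * (D₁ * T ^ (1 - (lam : ℝ))) with hKq
  have hKq0 : 0 ≤ Kq := by positivity
  have hq : ∀ t ∈ I, ∀ s ∈ I,
      ‖(f t - M (u t)) - (f s - M (u s))‖ ≤ Kq * |t - s| ^ (lam : ℝ) := by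
    intro t ht s hs
    have h1 := hCf.dist_le ht hs
    have h2 := hM.dist_le_mul (u t) (u s)
    rw [dist_eq_norm, Real.dist_eq] at h1
    rw [dist_eq_norm, dist_eq_norm] at h2
    have h3 := mul_le_mul_of_nonneg_left (hulip t ht s hs) L.coe_nonneg
    calc ‖(f t - M (u t)) - (f s - M (u s))‖ = ‖(f t - f s) - (M (u t) - M (u s))‖ := by
          congr 1; abel
      _ ≤ ‖f t - f s‖ + ‖M (u t) - M (u s)‖ := norm_sub_le _ _
      _ ≤ _ := by rw [hKq, add_mul]; linarith
  have hAu : ∀ t ∈ I, (u t, f t - M (u t) - u'' t) ∈ A.graph := by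
    intro t ht
    have h := hu.equation t ht
    have e : f t - M (u t) - u'' t = A ⟨u t, hu.mem_domain t ht⟩ := by
      rw [← h]; abel
    rw [e]
    exact A.mem_graph ⟨u t, hu.mem_domain t ht⟩
  have hAu_holder : ∀ t ∈ I, ∀ s ∈ I,
      ‖(f t - M (u t) - u'' t) - (f s - M (u s) - u'' s)‖ ≤ (Kq + Cu) * |t - s| ^ (lam : ℝ) := by
    intro t ht s hs
    have h1 := hCu.dist_le ht hs
    rw [dist_eq_norm, Real.dist_eq] at h1
    calc _ = ‖((f t - M (u t)) - (f s - M (u s))) - (u'' t - u'' s)‖ := by congr 1; abel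
      _ ≤ _ := norm_sub_le _ _
      _ ≤ _ := by rw [add_mul]; exact add_le_add (hq t ht s hs) h1
  have hAu_bound : ∀ t ∈ I, ‖f t - M (u t) - u'' t‖ ≤ Q + D₂ := fun t ht =>
    (norm_sub_le _ _).trans (add_le_add (hQ t ht) (hD₂ t ht))
  have hdec : ∀ t, ∃ w : Fin m → H, t ∈ I →
      (∀ j, (u t, w j) ∈ (Aj j).graph) ∧ f t - M (u t) - u'' t = ∑ j, w j := by
    intro t
    by_cases ht : t ∈ I
    · have h := hAu t ht
      rw [hsum] at h
      obtain ⟨w, hw, hws⟩ := LinearPMap.exists_graph_of_mem_graph_sum Aj Finset.univ h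
      exact ⟨w, fun _ => ⟨fun j => hw j (Finset.mem_univ j), hws⟩⟩
    · exact ⟨0, fun h => absurd h ht⟩
  choose a ha using hdec
  have hdom : ∀ j, A.domain ≤ (Aj j).domain := by
    intro j x hx
    obtain ⟨y, h⟩ := LinearPMap.mem_domain_iff.1 hx
    rw [hsum] at h
    obtain ⟨w, hw, -⟩ := LinearPMap.exists_graph_of_mem_graph_sum Aj Finset.univ h
    exact LinearPMap.mem_domain_of_mem_graph (hw j (Finset.mem_univ j))
  choose C hC0 hC using fun j =>
    hA.exists_relative_bound (hAj j).selfAdjoint.isClosed (hdom j)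
  set S : ℝ := ∑ j, C j with hS
  have hCS : ∀ j, C j ≤ S := fun j =>
    Finset.single_le_sum (fun i _ => hC0 i) (Finset.mem_univ j)
  have hS0 : 0 ≤ S := Finset.sum_nonneg fun j _ => hC0 j
  have hLeK : ∀ {x y z w v : ℝ}, 0 ≤ x → 0 ≤ y → 0 ≤ z → 0 ≤ w → 0 ≤ v →
      x ≤ x + y + z + w + v ∧ y ≤ x + y + z + w + v ∧ z ≤ x + y + z + w + v ∧
        w ≤ x + y + z + w + v ∧ v ≤ x + y + z + w + v := by
    intro x y z w v hx hy hz hw hv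
    refine ⟨?_, ?_, ?_, ?_, ?_⟩ <;> linarith
  have hSa : 0 ≤ S * (Kq + Cu) := by positivity
  have hSb : 0 ≤ S * (Q + D₂) := by positivity
  have hQC : 0 ≤ Q + Cu := by positivity
  obtain ⟨k1, k2, k3, k4, k5⟩ := hLeK hSa hSb hKq0 hQC hD₂0
  set K := S * (Kq + Cu) + S * (Q + D₂) + Kq + (Q + Cu) + D₂ with hK
  have hQK : Q ≤ K := le_trans (le_add_of_nonneg_right Cu.coe_nonneg) k4
  have hCuK : (Cu : ℝ) ≤ K := le_trans (le_add_of_nonneg_left hQ0) k4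
  have hrpow : ∀ x : ℝ, 0 ≤ |x| ^ (lam : ℝ) := fun x => Real.rpow_nonneg (abs_nonneg x) _
  refine ⟨K, a, hD₂0.trans k5, fun t ht => (ha t ht).1, fun t ht => ?_, fun t ht s hs j => ?_,
    fun t ht j => ?_, fun t ht s hs => ?_, fun t ht => (hQ t ht).trans hQK, fun t ht s hs => ?_,
    fun t ht s hs => ?_⟩
  · rw [← (ha t ht).2]; abel
  -- Graphs are subspaces, so the relative bound applies to differences in time and transfers the
  -- Hölder estimate from `A u` to `A_j u`.
  · have h1 := hC j (u t - u s) ((f t - M (u t) - u'' t) - (f s - M (u s) - u'' s)) (a t j - a s j)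
      (A.graph.sub_mem (hAu t ht) (hAu s hs))
      ((Aj j).graph.sub_mem ((ha t ht).1 j) ((ha s hs).1 j))
    refine h1.trans ?_
    calc C j * ‖(f t - M (u t) - u'' t) - (f s - M (u s) - u'' s)‖
        ≤ S * ((Kq + Cu) * |t - s| ^ (lam : ℝ)) :=
          mul_le_mul (hCS j) (hAu_holder t ht s hs) (norm_nonneg _) hS0
      _ ≤ K * |t - s| ^ (lam : ℝ) := by
          rw [← mul_assoc]
          exact mul_le_mul_of_nonneg_right k1 (hrpow _)
  · refine (hC j _ _ _ (hAu t ht) ((ha t ht).1 j)).trans (le_trans ?_ k2)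
    exact mul_le_mul (hCS j) (hAu_bound t ht) (norm_nonneg _) hS0
  · exact (hq t ht s hs).trans (mul_le_mul_of_nonneg_right k3 (hrpow _))
  · refine norm_taylor_two_le (convex_Icc 0 T) hd1 hd2 ht hs fun x hx => ?_
    have hxI : x ∈ I := (convex_Icc 0 T).segment_subset ht hs hx
    have h1 := hCu.dist_le hxI ht
    rw [dist_eq_norm, Real.dist_eq] at h1
    rw [segment_eq_uIcc] at hx
    have h2 : |x - t| ≤ |s - t| := abs_sub_left_of_mem_uIcc hx
    refine h1.trans ?_
    have hK0 : 0 ≤ K := hD₂0.trans k5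
    gcongr
  · have h := norm_taylor_two_le (convex_Icc 0 T) hd1 hd2 (p := 0) (ω := K) ht hs fun x hx => by
      rw [sub_zero]
      exact (hD₂ x ((convex_Icc 0 T).segment_subset ht hs hx)).trans k5
    rwa [smul_zero, sub_zero] at h

/-! ### Convergence of the scheme. -/

theorem mainTheorem4 {𝕜 H : Type*} [RCLike 𝕜] [NormedAddCommGroup H] [InnerProductSpace 𝕜 H]
    [NormedSpace ℝ H] [CompleteSpace H]
    (A : H →ₗ.[𝕜] H) (α : ℝ) (hA : IsSelfAdjointPosDef A α)
    (m : ℕ) (Aj : Fin m → (H →ₗ.[𝕜] H)) (αj : Fin m → ℝ)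
    (hAj : ∀ j, IsSelfAdjointPosDef (Aj j) (αj j)) (hsum : A = ∑ j, Aj j)
    (η : Fin m → ℝ) (hη0 : ∀ j, 0 < η j) (hη1 : ∀ j, η j < 1) (hη : ∑ j, η j = 1)
    (M : H → H) (a : NNReal) (hM : LipschitzWith a M)
    (T : ℝ) (hT : 0 < T) (f : ℝ → H) (hf : ContinuousOn f (Icc 0 T)) (φ₀ φ₁ : H)
    (u : ℝ → H) (hu : IsCauchySolution A M f φ₀ φ₁ T u)
    (lam : NNReal) (hlam0 : 0 < lam) (hlam1 : lam ≤ 1)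
    (hfH : ∃ C : NNReal, HolderOnWith C lam f (Icc 0 T))
    (huH : ∃ C : NNReal, HolderOnWith C lam (iteratedDerivWithin 2 u (Icc 0 T)) (Icc 0 T)) :
    ∃ c : ℝ, 0 < c ∧ ∀ n : ℕ, 1 < n → ∀ τ : ℝ, τ = T / n → ∀ v : ℕ → H,
      IsDecompositionScheme Aj η M f φ₀ φ₁ τ n v →
      ∀ k : ℕ, k ≤ n - 1 →
        ‖derivWithin u (Icc 0 T) (k * τ) - τ⁻¹ • (v (k + 1) - v k)‖ ≤ c * τ ^ (lam : ℝ) := by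
  let _ : InnerProductSpace ℝ H := InnerProductSpace.ofRCLike 𝕜 H
  obtain ⟨K, b, hK0, hb, hu'', hbH, hbB, hqH, hqB, hTay2, hTay1⟩ :=
    hu.exists_estimates hA hAj hsum hM hT hlam0 hlam1 hfH huH
  have hlam1' : (lam : ℝ) ≤ 1 := by exact_mod_cast hlam1
  have hm : 0 < m := by
    rcases Nat.eq_zero_or_pos m with rfl | h
    · simp at hη
    · exact h
  have hite : ∀ x : H, ∑ j : Fin m, (if (j : ℕ) = 0 then x else 0) = x := by
    intro x
    rw [Finset.sum_eq_single (⟨0, hm⟩ : Fin m)]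
    · simp
    · intro j _ hj
      exact if_neg fun h => hj (Fin.ext h)
    · simp
  set κ : ℝ := ∑ j, (η j)⁻¹ with hκ
  have hκ0 : 0 ≤ κ := Finset.sum_nonneg fun j _ => (inv_pos.2 (hη0 j)).le
  set Θ : ℝ := T ^ (1 - (lam : ℝ)) with hΘ
  have hΘ0 : 0 ≤ Θ := Real.rpow_nonneg hT.le _
  set X : ℝ := Real.exp (2 * T * a * T) with hX
  -- The multiple of `X` comes from stability, `K * Θ` from replacing `u'` by a difference quotient,
  -- and `1` ensures positivity.
  refine ⟨((8 * κ * K + 2 * K) * Θ + 2 * T * ((2 + m) * K + 2 * κ * K)) * X + K * Θ + 1,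
    by positivity, ?_⟩
  intro n hn τ hτ v hv k hk
  have hn0 : (0 : ℝ) < n := by exact_mod_cast (by omega : 0 < n)
  have hτ0 : 0 < τ := by rw [hτ]; positivity
  have hnτ : (n : ℝ) * τ = T := by rw [hτ]; field_simp
  set τl : ℝ := τ ^ (lam : ℝ) with hτl
  have hτl0 : 0 ≤ τl := Real.rpow_nonneg hτ0.le _
  have hmem : ∀ i : ℕ, i ≤ n → (i : ℝ) * τ ∈ Icc 0 T := fun i hi =>
    ⟨by positivity, by
      rw [← hnτ]
      exact mul_le_mul_of_nonneg_right (by exact_mod_cast hi) hτ0.le⟩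
  have hτΘ : τ ≤ Θ * τl := by
    have hτT : |τ - 0| ≤ T := by
      have h := (hmem 1 (by omega)).2
      rwa [sub_zero, abs_of_pos hτ0, ← one_mul τ, ← Nat.cast_one (R := ℝ)]
    have h := abs_sub_le_mul_rpow hT hlam1' hτT
    rwa [sub_zero, abs_of_pos hτ0] at h
  have hstep : ∀ i : ℕ, ((i + 1 : ℕ) : ℝ) * τ - i * τ = τ := fun i => by push_cast; ring
  have hstep' : ∀ i : ℕ, (i : ℝ) * τ - ((i + 1 : ℕ) : ℝ) * τ = -τ := fun i => by push_cast; ring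
  have habs : ∀ i : ℕ, |((i + 1 : ℕ) : ℝ) * τ - i * τ| = τ := fun i => by
    rw [hstep, abs_of_pos hτ0]
  have hτ2 : (0 : ℝ) < τ ^ 2 := by positivity
  choose P hPsymm hPfirm hPgraph hPres using fun j =>
    (hAj j).exists_one_sub_resolvent (div_pos hτ2 (hη0 j))
  have hPsub : ∀ j x, ‖x - P j x‖ ≤ ‖x‖ := fun j x => norm_sub_apply_le_of_firm (hPfirm j x)
  have hηc : ∀ j, η j * (τ ^ 2 / η j) = τ ^ 2 := fun j => mul_div_cancel₀ _ (hη0 j).ne'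
  set z : ℕ → H := fun i => u (i * τ) - v i with hz
  let q : ℝ → H := fun t => f t - M (u t)
  let D : ℕ → Fin m → H := fun i j => if (j : ℕ) = 0 then M (v i) - M (u (i * τ)) else 0
  -- Components of `u''(t_i)` along the splitting.
  let g : ℕ → Fin m → H := fun i j => (if (j : ℕ) = 0 then q (i * τ) else 0) - b (i * τ) j
  let e : ℕ → H := fun i => u ((i + 2 : ℕ) * τ) - (2 : ℝ) • u ((i + 1 : ℕ) * τ) + u (i * τ) -
    τ ^ 2 • iteratedDerivWithin 2 u (Icc 0 T) ((i + 1 : ℕ) * τ)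
  -- `A_j` maps the extrapolation `2 u(t_{i+1}) - u(t_i)` to `b(t_{i+1}) j + β i j`.
  let β : ℕ → Fin m → H := fun i j => b ((i + 1 : ℕ) * τ) j - b (i * τ) j
  let ρ : ℕ → H := fun i => e i + τ ^ 2 • ∑ j, ((D (i + 1) j - P j (D (i + 1) j)) +
    (β i j - P j (β i j)))
  have he : ∀ i, i + 1 < n → ‖e i‖ ≤ 2 * K * τl * τ ^ 2 := by
    intro i hi
    have h1 := hTay2 _ (hmem (i + 1) (by omega)) _ (hmem (i + 2) (by omega))
    have h2 := hTay2 _ (hmem (i + 1) (by omega)) _ (hmem i (by omega))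
    rw [hstep (i + 1), abs_of_pos hτ0] at h1
    rw [hstep' i, abs_neg, abs_of_pos hτ0, neg_sq] at h2
    refine le_trans (le_of_eq ?_) ((norm_add_le_of_le h1 h2).trans (le_of_eq (by ring)))
    congr 1
    simp only [e]
    module
  have hz0 : z 0 = 0 := by simp [hz, hv.zero, hu.initial_value]
  have hz1 : ‖z 1‖ ≤ K * τ ^ 2 := by
    have h := hTay1 _ (hmem 0 (by omega)) _ (hmem 1 (by omega))
    rw [hstep 0, abs_of_pos hτ0] at h
    simp only [Nat.cast_zero, zero_mul, hu.initial_value, hu.initial_deriv] at h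
    simp only [hz, hv.one]
    rwa [← sub_sub]
  have hrec : ∀ i, i + 1 < n → z (i + 2) = (2 : ℝ) • z (i + 1) - z i
      - (∑ j, η j • P j) ((2 : ℝ) • z (i + 1) - z i) +
        (ρ i + ∑ j, P j (τ ^ 2 • g (i + 1) j)) := by
    intro i hi
    obtain ⟨y, hy, hvy⟩ := hv.step (i + 1) (by omega) (by omega)
    rw [Nat.add_sub_cancel] at hy
    have ht0 := hmem i (by omega)
    have ht1 := hmem (i + 1) (by omega)
    have hw : (2 : ℝ) • z (i + 1) - z i = ((2 : ℝ) • u ((i + 1 : ℕ) * τ) - u (i * τ)) -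
        ((2 : ℝ) • v (i + 1) - v i) := by
      simp only [hz]; module
    have hD : ∀ j, D (i + 1) j = (if (j : ℕ) = 0 then q ((i + 1 : ℕ) * τ) else 0) -
        (if (j : ℕ) = 0 then f ((i + 1 : ℕ) * τ) - M (v (i + 1)) else 0) := by
      intro j
      simp only [D, q]
      split_ifs
      · abel
      · rw [sub_zero]
    rw [hw]
    simp only [ρ, hD]
    refine decomposition_step_error (y := fun j => (y j : H))
      (a := b ((i + 1 : ℕ) * τ)) hη (fun j => ?_) (fun j => ?_) ?_ hvy
    · have hgr : ((2 : ℝ) • u ((i + 1 : ℕ) * τ) - u (i * τ),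
          b ((i + 1 : ℕ) * τ) j + β i j) ∈ (Aj j).graph := by
        have h := (Aj j).graph.sub_mem
          ((Aj j).graph.add_mem (hb _ ht1 j) (hb _ ht1 j)) (hb _ ht0 j)
        convert h using 1
        refine Prod.ext ?_ ?_
        · change _ = u _ + u _ - u _
          rw [two_smul]
        · change _ = b _ j + b _ j - b _ j
          simp only [β]
          abel
      rw [hPgraph j _ _ hgr, smul_smul, hηc]
    · have h1 := hPres j _ _ ((Aj j).mem_graph (y j))
      set Gv : H := if (j : ℕ) = 0 then f ((i + 1 : ℕ) * τ) - M (v (i + 1)) else 0 with hGv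
      -- The implicit equation divided by `η_j / τ²`, ready for the resolvent identity `hPres`.
      have h2 : (y j : H) + (τ ^ 2 / η j) • Aj j (y j) =
          ((2 : ℝ) • v (i + 1) - v i) + (τ ^ 2 / η j) • Gv := by
        have hs : Aj j (y j) =
            Gv - η j • ((τ ^ 2)⁻¹ • ((y j : H) - (2 : ℝ) • v (i + 1) + v i)) :=
          eq_sub_of_add_eq' (hy j)
        have hc : τ ^ 2 / η j * (η j * (τ ^ 2)⁻¹) = 1 := by
          have := (hη0 j).ne'
          field_simp
        rw [hs, smul_sub, smul_smul (η j), smul_smul (τ ^ 2 / η j), hc, one_smul]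
        abel
      have h3 : (τ ^ 2 / η j) • Aj j (y j) =
          ((2 : ℝ) • v (i + 1) - v i) + (τ ^ 2 / η j) • Gv - (y j : H) := by
        rw [← h2]; abel
      rw [h2, h3, map_add, map_smul] at h1
      have h4 : (y j : H) = ((2 : ℝ) • v (i + 1) - v i) + (τ ^ 2 / η j) • Gv -
          (P j ((2 : ℝ) • v (i + 1) - v i) + (τ ^ 2 / η j) • P j Gv) := by
        rw [h1]; abel
      change η j • (y j : H) = _
      rw [h4, smul_sub, smul_add, smul_add, smul_smul, smul_smul, hηc, smul_sub (η j),
        smul_sub (τ ^ 2)]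
      abel
    · rw [Finset.sum_sub_distrib, hite, ← hu'' _ ht1]
      simp only [e]
      abel
  -- The range reaches the node `t_n`, which the boundary term of the summation by parts needs.
  have hgB : ∀ i < n, ∀ j, ‖τ ^ 2 • g (i + 1) j‖ ≤ τ ^ 2 * (2 * K) := by
    intro i hi j
    have ht := hmem (i + 1) (by omega)
    rw [norm_smul, Real.norm_of_nonneg hτ2.le]
    refine mul_le_mul_of_nonneg_left ?_ hτ2.le
    rw [two_mul]
    refine (norm_sub_le _ _).trans (add_le_add ?_ (hbB _ ht j))
    split_ifs
    · exact hqB _ ht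
    · rwa [norm_zero]
  have hgH : ∀ i, i + 1 < n → ∀ j,
      ‖τ ^ 2 • g (i + 1 + 1) j - τ ^ 2 • g (i + 1) j‖ ≤ τ ^ 2 * (2 * K * τl) := by
    intro i hi j
    have ht := hmem (i + 1) (by omega)
    have ht' := hmem (i + 1 + 1) (by omega)
    rw [← smul_sub, norm_smul, Real.norm_of_nonneg hτ2.le]
    refine mul_le_mul_of_nonneg_left ?_ hτ2.le
    have h1 := hbH _ ht' _ ht j
    have h2 := hqH _ ht' _ ht
    rw [habs] at h1 h2
    simp only [g]
    rw [sub_sub_sub_comm, mul_assoc, two_mul]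
    refine (norm_sub_le _ _).trans (add_le_add ?_ h1)
    split_ifs
    · exact h2
    · rw [sub_zero, norm_zero]; positivity
  have hρ : ∀ i, i + 1 < n → ‖ρ i‖ ≤ (2 + m) * K * τl * τ ^ 2 + a * τ ^ 2 * ‖z (i + 1)‖ := by
    intro i hi
    have hDsum : ∑ j, ‖D (i + 1) j‖ ≤ a * ‖z (i + 1)‖ := by
      rw [Finset.sum_eq_single (⟨0, hm⟩ : Fin m)]
      · simp only [D, if_true]
        have h := hM.dist_le_mul (v (i + 1)) (u ((i + 1 : ℕ) * τ))
        rwa [dist_eq_norm, dist_comm, dist_eq_norm] at h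
      · intro j _ hj
        simp only [D, if_neg fun h => hj (Fin.ext h), norm_zero]
      · simp
    have hβ : ∀ j, ‖β i j‖ ≤ K * τl := fun j => by
      have h := hbH _ (hmem (i + 1) (by omega)) _ (hmem i (by omega)) j
      rwa [habs] at h
    have hS : ‖∑ j, ((D (i + 1) j - P j (D (i + 1) j)) + (β i j - P j (β i j)))‖ ≤
        a * ‖z (i + 1)‖ + m * (K * τl) := by
      calc _ ≤ ∑ j, (‖D (i + 1) j‖ + K * τl) := norm_sum_le_of_le _ fun j _ =>
            norm_add_le_of_le (hPsub j _) ((hPsub j _).trans (hβ j))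
        _ ≤ _ := by
            rw [Finset.sum_add_distrib, Finset.sum_const, Finset.card_univ, Fintype.card_fin,
              nsmul_eq_mul]
            linarith
    refine (norm_add_le_of_le (he i hi) (le_of_eq (norm_smul _ _))).trans ?_
    rw [Real.norm_of_nonneg hτ2.le]
    have := mul_le_mul_of_nonneg_left hS hτ2.le
    linarith
  have hkn : k < n := by omega
  have hmain := norm_increment_le_of_recursion hPsymm hPfirm hη0 (fun j => (hη1 j).le) hη
    (by positivity) (by positivity) (by positivity) (by positivity) hz0 hrec hgB hgH hρ k hkn
  -- Since `n τ = T`, the growth factor per step is `1 + 2 T a τ`, and `k τ ≤ T`.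
  have hpow : (1 + 2 * n * (a * τ ^ 2)) ^ k ≤ X := by
    have e1 : 2 * (n : ℝ) * (a * τ ^ 2) = 2 * T * a * τ := by rw [← hnτ]; ring
    rw [e1, add_comm]
    calc (2 * T * a * τ + 1) ^ k ≤ Real.exp (2 * T * a * τ) ^ k :=
          pow_le_pow_left₀ (by positivity) (Real.add_one_le_exp _) k
      _ = Real.exp (2 * T * a * (k * τ)) := by rw [← Real.exp_nat_mul]; congr 1; ring
      _ ≤ X := by
          refine Real.exp_le_exp.2 (mul_le_mul_of_nonneg_left ?_ (by positivity))
          exact (hmem k hkn.le).2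
  have hbase : 4 * κ * (τ ^ 2 * (2 * K)) + 2 * ‖z 1‖ +
      2 * n * ((2 + m) * K * τl * τ ^ 2 + κ * (τ ^ 2 * (2 * K * τl))) ≤
      τ * (((8 * κ * K + 2 * K) * Θ + 2 * T * ((2 + m) * K + 2 * κ * K)) * τl) := by
    have h1 : (8 * κ * K + 2 * K) * τ ≤ (8 * κ * K + 2 * K) * (Θ * τl) :=
      mul_le_mul_of_nonneg_left hτΘ (by positivity)
    have h2 := mul_le_mul_of_nonneg_left h1 hτ0.le
    rw [← hnτ]
    nlinarith
  have hinc : ‖z (k + 1) - z k‖ ≤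
      τ * (((8 * κ * K + 2 * K) * Θ + 2 * T * ((2 + m) * K + 2 * κ * K)) * τl) * X :=
    hmain.trans (mul_le_mul hbase hpow (by positivity) (by positivity))
  have hdiff : ‖τ • derivWithin u (Icc 0 T) (k * τ) - (v (k + 1) - v k)‖ ≤
      K * τ ^ 2 + ‖z (k + 1) - z k‖ := by
    have h := hTay1 _ (hmem k hkn.le) _ (hmem (k + 1) (by omega))
    rw [hstep, abs_of_pos hτ0] at h
    have e1 : τ • derivWithin u (Icc 0 T) (k * τ) - (v (k + 1) - v k) =
        (z (k + 1) - z k) - (u ((k + 1 : ℕ) * τ) - u (k * τ) -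
          τ • derivWithin u (Icc 0 T) (k * τ)) := by
      simp only [hz]; abel
    rw [e1, add_comm (K * τ ^ 2)]
    exact norm_sub_le_of_le le_rfl h
  have hfin : ‖derivWithin u (Icc 0 T) (k * τ) - τ⁻¹ • (v (k + 1) - v k)‖ =
      τ⁻¹ * ‖τ • derivWithin u (Icc 0 T) (k * τ) - (v (k + 1) - v k)‖ := by
    have h := norm_smul τ⁻¹ (τ • derivWithin u (Icc 0 T) (k * τ) - (v (k + 1) - v k))
    rwa [smul_sub τ⁻¹, smul_smul, inv_mul_cancel₀ hτ0.ne', one_smul,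
      Real.norm_of_nonneg (inv_pos.2 hτ0).le] at h
  rw [hfin, inv_mul_le_iff₀ hτ0]
  refine hdiff.trans ?_
  have h5 := mul_le_mul_of_nonneg_left hτΘ (mul_nonneg hK0 hτ0.le)
  have h6 : 0 ≤ τ * τl := by positivity
  calc K * τ ^ 2 + ‖z (k + 1) - z k‖ ≤ K * τ * (Θ * τl) +
        τ * (((8 * κ * K + 2 * K) * Θ + 2 * T * ((2 + m) * K + 2 * κ * K)) * τl) * X := by
        refine add_le_add (le_trans (le_of_eq (by ring)) h5) hinc
    _ ≤ _ := by linarith
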